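/- Let $q\ge 1$ and let $A=(a_1,\dots,a_q)$, $B=(b_1,\dots,b_q)$ be real vectors such that $B$ is weakly supermajorized by $A$, that is, $0<a_1\le a_2\le\dots\le a_q$, $0<b_1\le b_2\le\dots\le b_q$ and $$\sum_{i=1}^k a_i\le\sum_{i=1}^k b_i\qquad (k=1,\dots,q).$$ Assume that $A\neq B$ and that $a_1>1$, $b_1>1$, and let $0<\sigma\le 1$. Then the series $$\sum_{n=0}^\infty\frac{(\sigma)_n(a_1)_n\cdots(a_q)_n}{(b_1)_n\cdots(b_q)_n\,n!}\,z^n,$$ where $(a)_0=1$ and $(a)_n=a(a+1)\cdots(a+n-1)$ for $n\ge1$, converges for $|z|<1$ and its sum extends (uniquely) to a holomorphic function ${}_{q+1}F_q(\sigma,A;B;z)$ on $\mathbb{C}\setminus[1,\infty)$; and for every $x>0$ the value ${}_{q+1}F_q(\sigma,A;B;-x)$ is real and $${}_{q+1}F_q(\sigma,A;B;-x)<\frac{1}{\Bigl(1+x\prod_{i=1}^{q}\frac{a_i-1}{b_i-1}\Bigr)^{\sigma}}.$$ -/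

import Mathlib

/-- The `n`-th term of the series of `_{q+1}F_q(σ, A; B; z)`, that is
`(σ)_n (a_1)_n ⋯ (a_q)_n / ((b_1)_n ⋯ (b_q)_n n!) z^n`, where `(a)_n` is the rising factorial. -/
noncomputable def hypTerm {q : ℕ} (σ : ℂ) (A B : Fin q → ℂ) (z : ℂ) (n : ℕ) : ℂ :=
  ((ascPochhammer ℂ n).eval σ * ∏ i, (ascPochhammer ℂ n).eval (A i)) /
    ((∏ i, (ascPochhammer ℂ n).eval (B i)) * (n.factorial : ℂ)) * z ^ n

/-- The complex plane cut along the ray `[1, ∞)`. -/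
def cutPlane : Set ℂ := {z | z.im = 0 → z.re < 1}

/-- `F` is holomorphic on the plane cut along `[1, ∞)`, and on the unit disk it is the sum of the
(convergent) series of `_{q+1}F_q(σ, A; B; ·)`. -/
structure IsHypContinuation {q : ℕ} (σ : ℂ) (A B : Fin q → ℂ) (F : ℂ → ℂ) : Prop where
  analytic : AnalyticOnNhd ℂ F cutPlane
  hasSum : ∀ z : ℂ, ‖z‖ < 1 → HasSum (hypTerm σ A B z) (F z)

lemma cutPlane_eq : cutPlane = (fun z : ℂ => 1 - z) '' Complex.slitPlane := by
  ext z
  simp only [cutPlane, Set.mem_ofPred_eq, Set.mem_image]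
  constructor
  · intro h
    refine ⟨1 - z, ?_, by ring⟩
    rw [Complex.mem_slitPlane_iff]
    by_cases hz : z.im = 0
    · left
      have := h hz
      simp only [Complex.sub_re, Complex.one_re]
      linarith
    · right
      simpa using hz
  · rintro ⟨w, hw, rfl⟩ him
    rw [Complex.mem_slitPlane_iff] at hw
    have h0 : w.im = 0 := by simpa using him
    rcases hw with hw | hw
    · simp only [Complex.sub_re, Complex.one_re]
      linarith
    · exact absurd h0 hw

/-- The analytic continuation is unique: two of them agree on the cut plane. -/
lemma IsHypContinuation.eqOn {q : ℕ} {σ : ℂ} {A B : Fin q → ℂ} {F G : ℂ → ℂ}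
    (hF : IsHypContinuation σ A B F) (hG : IsHypContinuation σ A B G) :
    Set.EqOn F G cutPlane := by
  have hconn : IsPreconnected cutPlane := by
    rw [cutPlane_eq]
    have h1 : IsPreconnected Complex.slitPlane :=
      (Complex.starConvex_one_slitPlane.isPathConnected
        Complex.one_mem_slitPlane).isConnected.isPreconnected
    exact h1.image _ (by fun_prop)
  refine hF.analytic.eqOn_of_preconnected_of_eventuallyEq hG.analytic hconn
    (z₀ := 0) (by simp [cutPlane]) ?_
  filter_upwards [Metric.ball_mem_nhds (0 : ℂ) one_pos] with z hz
  have hz' : ‖z‖ < 1 := by simpa using hz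
  exact (hF.hasSum z hz').unique (hG.hasSum z hz')

open Classical in
/-- The generalized hypergeometric function `_{q+1}F_q(σ, A; B; ·)`: the analytic continuation of
its series to the plane cut along `[1, ∞)`. Its values on the cut, and its values when there is no
such continuation, carry no meaning. -/
noncomputable def genHyp {q : ℕ} (σ : ℂ) (A B : Fin q → ℂ) : ℂ → ℂ :=
  if h : ∃ F, IsHypContinuation σ A B F then h.choose else 0

/-- Every analytic continuation of the series agrees with `genHyp` on the cut plane. -/
lemma IsHypContinuation.genHyp_eqOn {q : ℕ} {σ : ℂ} {A B : Fin q → ℂ} {F : ℂ → ℂ}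
    (hF : IsHypContinuation σ A B F) : Set.EqOn (genHyp σ A B) F cutPlane := by
  have h : ∃ F, IsHypContinuation σ A B F := ⟨F, hF⟩
  rw [genHyp, dif_pos h]
  exact h.choose_spec.eqOn hF

/-- `B` is weakly supermajorized by `A`: both are positive and nondecreasing, and
`∑_{i ≤ k} a_i ≤ ∑_{i ≤ k} b_i` for every `k`. -/
structure WeaklySupermajorizedBy {q : ℕ} (B A : Fin q → ℝ) : Prop where
  pos_A : ∀ i, 0 < A i
  mono_A : Monotone A
  pos_B : ∀ i, 0 < B i
  mono_B : Monotone B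
  sum_le : ∀ k : Fin q, ∑ i ∈ Finset.Iic k, A i ≤ ∑ i ∈ Finset.Iic k, B i

open MeasureTheory Filter Topology

/-! Lower all parameters by 1; the majorization survives and they stay positive. By
`pochRatio_of_sum_le` the ratios for `A - 1`, `B - 1` are the moments of a probability measure `ν`
on `[0, 1]`, with mean `c = ∏ (a_i - 1) / (b_i - 1)`. Dropping the first moment shows that `(t / c)
dν` has the moments `pochRatio A B n`, so the hypergeometric function is `∫ (t / c) (1 - z t) ^ (-σ)
dν`. At `z = -x` the integrand is `1 / c` times a strictly concave function of `t`
(`strictConcaveOn_mul_rpow`), and Jensen gives the bound. It is strict because a point mass `ν`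
would force `A = B` (`eq_of_pochRatio_eq_pow`).

The measure comes from closure of moment sequences under products, mixtures and limits: `A` is
carried to `B` by transfers between two coordinates followed by coordinatewise increases, and each
move is an infinite product of elementary moment sequences. -/

/-- The sequence `m` is the moment sequence of a probability measure on `[0, 1]`. -/
def IsHausdorffMoment (m : ℕ → ℝ) : Prop :=
  ∃ ν : ProbabilityMeasure unitInterval, ∀ n, ∫ t, (t : ℝ) ^ n ∂(ν : Measure unitInterval) = m n

lemma integrable_of_continuous_unitInterval {E : Type*} [NormedAddCommGroup E]
    (μ : Measure unitInterval) [IsFiniteMeasure μ] {f : unitInterval → E} (hf : Continuous f) :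
    Integrable f μ := by
  rw [← integrableOn_univ]
  exact hf.continuousOn.integrableOn_compact isCompact_univ

/-! ### Closure properties of moment sequences -/

namespace IsHausdorffMoment

lemma one : IsHausdorffMoment fun _ => 1 :=
  ⟨⟨Measure.dirac 1, inferInstance⟩, fun n => by simp⟩

/-- Multiply independent random variables with the two given laws. -/
lemma mul {m m' : ℕ → ℝ} (h : IsHausdorffMoment m) (h' : IsHausdorffMoment m') :
    IsHausdorffMoment fun n => m n * m' n := by
  obtain ⟨ν, hν⟩ := h
  obtain ⟨ν', hν'⟩ := h'
  have hmeas : Measurable fun p : unitInterval × unitInterval => p.1 * p.2 :=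
    continuous_mul.measurable
  refine ⟨⟨((ν : Measure unitInterval).prod ν').map fun p => p.1 * p.2,
    Measure.isProbabilityMeasure_map hmeas.aemeasurable⟩, fun n => ?_⟩
  rw [ProbabilityMeasure.coe_mk, integral_map hmeas.aemeasurable
    (Continuous.aestronglyMeasurable (by fun_prop))]
  simp only [Set.Icc.coe_mul, mul_pow]
  rw [integral_prod_mul (fun t : unitInterval => (t : ℝ) ^ n) fun t : unitInterval => (t : ℝ) ^ n,
    hν, hν']

lemma convexComb {m m' : ℕ → ℝ} (h : IsHausdorffMoment m) (h' : IsHausdorffMoment m') {p r : ℝ}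
    (hp : 0 ≤ p) (hr : 0 ≤ r) (hpr : p + r = 1) :
    IsHausdorffMoment fun n => p * m n + r * m' n := by
  obtain ⟨ν, hν⟩ := h
  obtain ⟨ν', hν'⟩ := h'
  refine ⟨⟨ENNReal.ofReal p • (ν : Measure unitInterval) + ENNReal.ofReal r • ν', ⟨?_⟩⟩,
    fun n => ?_⟩
  · simp [← ENNReal.ofReal_add hp hr, hpr]
  · have hc : Continuous fun t : unitInterval => (t : ℝ) ^ n := by fun_prop
    rw [ProbabilityMeasure.coe_mk, integral_add_measure
      ((integrable_of_continuous_unitInterval _ hc).smul_measure ENNReal.ofReal_ne_top)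
      ((integrable_of_continuous_unitInterval _ hc).smul_measure ENNReal.ofReal_ne_top),
      integral_smul_measure, integral_smul_measure, hν, hν',
      ENNReal.toReal_ofReal hp, ENNReal.toReal_ofReal hr, smul_eq_mul, smul_eq_mul]

/-- This is the law of `U ^ (1 / a)` with `U` uniform on `[0, 1]`. -/
lemma div_add {a : ℝ} (ha : 0 < a) : IsHausdorffMoment fun n => a / (a + n) := by
  have hmem : ∀ t : unitInterval, (t : ℝ) ^ (1 / a) ∈ unitInterval := fun t =>
    ⟨Real.rpow_nonneg t.2.1 _, Real.rpow_le_one t.2.1 t.2.2 (by positivity)⟩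
  have hcont : Continuous fun t : unitInterval => (⟨(t : ℝ) ^ (1 / a), hmem t⟩ : unitInterval) :=
    Continuous.subtype_mk
      (continuous_subtype_val.rpow_const fun _ => Or.inr (by positivity)) _
  refine ⟨⟨volume.map fun t : unitInterval => (⟨(t : ℝ) ^ (1 / a), hmem t⟩ : unitInterval),
    Measure.isProbabilityMeasure_map hcont.measurable.aemeasurable⟩, fun n => ?_⟩
  rw [ProbabilityMeasure.coe_mk, integral_map hcont.measurable.aemeasurable
    (Continuous.aestronglyMeasurable (by fun_prop))]
  have h1 : ∀ t : unitInterval, ((t : ℝ) ^ (1 / a)) ^ n = (t : ℝ) ^ (n / a) := fun t => by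
    rw [← Real.rpow_natCast, ← Real.rpow_mul t.2.1]
    congr 1
    ring
  simp only [h1]
  rw [unitInterval.volume_def, integral_subtype_comap (μ := (volume : Measure ℝ))
    measurableSet_Icc (fun t : ℝ => t ^ (n / a : ℝ)), integral_Icc_eq_integral_Ioc,
    ← intervalIntegral.integral_of_le zero_le_one, integral_rpow (Or.inl (by
      have : (0 : ℝ) ≤ n / a := by positivity
      linarith))]
  have h2 : (n / a + 1 : ℝ) ≠ 0 := by positivity
  rw [Real.zero_rpow h2, Real.one_rpow]
  field_simp
  ring

/-- Probability measures on `[0, 1]` are weakly compact, and each moment is weakly continuous, so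
any cluster point of the measures will do. -/
lemma of_tendsto {m : ℕ → ℕ → ℝ} {l : ℕ → ℝ} (h : ∀ N, IsHausdorffMoment (m N))
    (hl : ∀ n, Tendsto (fun N => m N n) atTop (𝓝 (l n))) : IsHausdorffMoment l := by
  choose ν hν using h
  obtain ⟨ν₀, hν₀⟩ := exists_clusterPt_of_compactSpace (map ν atTop)
  obtain ⟨U, hU, hUν⟩ := mapClusterPt_iff_ultrafilter.mp hν₀
  refine ⟨ν₀, fun n => ?_⟩
  have h1 := (ProbabilityMeasure.tendsto_iff_forall_integral_tendsto.mp hUν)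
    (BoundedContinuousFunction.mkOfCompact ⟨fun t : unitInterval => (t : ℝ) ^ n, by fun_prop⟩)
  have h2 : Tendsto (fun N => m N n) U
      (𝓝 (∫ t, (t : ℝ) ^ n ∂(ν₀ : Measure unitInterval))) := by
    simpa [hν] using h1
  exact tendsto_nhds_unique h2 ((hl n).mono_left hU)

end IsHausdorffMoment

/-! ### Ratios of rising factorials -/

/-- The product `∏ i, (A i)_n / (B i)_n` of ratios of rising factorials. -/
noncomputable def pochRatio {q : ℕ} (A B : Fin q → ℝ) (n : ℕ) : ℝ :=
  ∏ i, (ascPochhammer ℝ n).eval (A i) / (ascPochhammer ℝ n).eval (B i)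

lemma ascPochhammer_eval_mul_add (a : ℝ) (n : ℕ) :
    (ascPochhammer ℝ n).eval a * (a + n) = a * (ascPochhammer ℝ n).eval (a + 1) := by
  rw [← ascPochhammer_succ_eval, ascPochhammer_succ_left]
  simp

lemma ascPochhammer_ratio_shift {a b : ℝ} (ha : 0 < a) (hb : 0 < b) (n : ℕ) :
    (ascPochhammer ℝ n).eval a / (ascPochhammer ℝ n).eval b =
      a * (b + n) / ((a + n) * b) *
        ((ascPochhammer ℝ n).eval (a + 1) / (ascPochhammer ℝ n).eval (b + 1)) := by
  have h1 := ascPochhammer_pos n b hb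
  have h2 := ascPochhammer_pos n (b + 1) (by linarith)
  have h3 := ascPochhammer_eval_mul_add a n
  have h4 := ascPochhammer_eval_mul_add b n
  have h5 : 0 < a + n := by positivity
  rw [div_mul_div_comm, div_eq_div_iff (by positivity) (by positivity)]
  linear_combination (b * (ascPochhammer ℝ n).eval (b + 1)) * h3 -
    (a * (ascPochhammer ℝ n).eval (a + 1)) * h4

/-- Iterating the shift by 1 leaves a remainder that tends to 1, so the ratio becomes an infinite
product of rational functions of `n`. -/
lemma pochRatio_eq_prod_mul {q : ℕ} {A B : Fin q → ℝ} (hA : ∀ i, 0 < A i) (hB : ∀ i, 0 < B i)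
    (N n : ℕ) :
    pochRatio A B n =
      (∏ k ∈ Finset.range N, ∏ i, (A i + k) * (B i + k + n) / ((A i + k + n) * (B i + k))) *
        pochRatio (fun i => A i + N) (fun i => B i + N) n := by
  induction N with
  | zero => simp
  | succ N ih =>
    rw [ih, Finset.prod_range_succ, mul_assoc]
    congr 1
    rw [pochRatio, pochRatio, ← Finset.prod_mul_distrib]
    refine Finset.prod_congr rfl fun i _ => ?_
    have h1 := hA i
    have h2 := hB i
    rw [ascPochhammer_ratio_shift (by positivity) (by positivity)]
    push_cast
    simp only [add_assoc]

lemma tendsto_ascPochhammer_ratio (a b : ℝ) (n : ℕ) :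
    Tendsto (fun N : ℕ => (ascPochhammer ℝ n).eval (a + N) / (ascPochhammer ℝ n).eval (b + N))
      atTop (𝓝 1) := by
  induction n with
  | zero => simp
  | succ n ih =>
    have h : Tendsto (fun N : ℕ => (a + N + n) / (b + N + n : ℝ)) atTop (𝓝 1) := by
      have := tendsto_add_mul_div_add_mul_atTop_nhds (a + n) (b + n) (1 : ℝ) (d := (1 : ℝ))
        one_ne_zero
      simp only [one_mul, div_one] at this
      exact this.congr fun N => by congr 1 <;> ring
    simpa [ascPochhammer_succ_eval, mul_div_mul_comm] using ih.mul h

lemma tendsto_pochRatio_one {q : ℕ} (A B : Fin q → ℝ) (n : ℕ) :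
    Tendsto (fun N : ℕ => pochRatio (fun i => A i + N) (fun i => B i + N) n) atTop (𝓝 1) := by
  simpa [pochRatio] using
    tendsto_finsetProd Finset.univ fun i _ => tendsto_ascPochhammer_ratio (A i) (B i) n

lemma pochRatio_pos {q : ℕ} {A B : Fin q → ℝ} (hA : ∀ i, 0 < A i) (hB : ∀ i, 0 < B i)
    (n : ℕ) : 0 < pochRatio A B n :=
  Finset.prod_pos fun i _ => div_pos (ascPochhammer_pos n _ (hA i)) (ascPochhammer_pos n _ (hB i))

lemma pochRatio_trans {q : ℕ} (A B : Fin q → ℝ) {C : Fin q → ℝ} (hC : ∀ i, 0 < C i) (n : ℕ) :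
    pochRatio A B n = pochRatio A C n * pochRatio C B n := by
  rw [pochRatio, pochRatio, pochRatio, ← Finset.prod_mul_distrib]
  refine Finset.prod_congr rfl fun i _ => ?_
  rw [div_mul_div_cancel₀ (ascPochhammer_pos n _ (hC i)).ne']

/-! ### Moment sequences from majorization -/

namespace IsHausdorffMoment

lemma prod {ι : Type*} (s : Finset ι) {m : ι → ℕ → ℝ} (h : ∀ k ∈ s, IsHausdorffMoment (m k)) :
    IsHausdorffMoment fun n => ∏ k ∈ s, m k n := by
  classical
  induction s using Finset.induction_on with
  | empty => simpa using one
  | insert k s hk ih =>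
    simp only [Finset.prod_insert hk]
    exact (h k (Finset.mem_insert_self k s)).mul
      (ih fun j hj => h j (Finset.mem_insert_of_mem hj))

lemma pochRatio_of_factor {q : ℕ} {A B : Fin q → ℝ} (hA : ∀ i, 0 < A i) (hB : ∀ i, 0 < B i)
    (h : ∀ k : ℕ, IsHausdorffMoment fun n =>
      ∏ i, (A i + k) * (B i + k + n) / ((A i + k + n) * (B i + k))) :
    IsHausdorffMoment (pochRatio A B) := by
  refine of_tendsto (m := fun N n => ∏ k ∈ Finset.range N,
    ∏ i, (A i + k) * (B i + k + n) / ((A i + k + n) * (B i + k)))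
    (fun N => prod _ fun k _ => h k) fun n => ?_
  have h1 : Tendsto (fun N : ℕ => pochRatio A B n /
      pochRatio (fun i => A i + N) (fun i => B i + N) n) atTop (𝓝 (pochRatio A B n / 1)) :=
    tendsto_const_nhds.div (tendsto_pochRatio_one A B n) one_ne_zero
  rw [div_one] at h1
  refine h1.congr fun N => ?_
  have h2 : 0 < pochRatio (fun i => A i + N) (fun i => B i + N) n :=
    pochRatio_pos (fun i => by have := hA i; positivity) (fun i => by have := hB i; positivity) n
  rw [pochRatio_eq_prod_mul hA hB N n, mul_div_cancel_right₀ _ h2.ne']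

/-- The factor equals `a / b + ((b - a) / b) * (a / (a + n))`, a mixture. -/
lemma factor_of_le {a b : ℝ} (ha : 0 < a) (hab : a ≤ b) :
    IsHausdorffMoment fun n => a * (b + n) / ((a + n) * b) := by
  have hb : 0 < b := ha.trans_le hab
  convert one.convexComb (div_add ha) (p := a / b) (r := (b - a) / b) (by positivity)
    (div_nonneg (by linarith) hb.le) (by field_simp; ring) using 2 with n
  have : 0 < a + n := by positivity
  field_simp
  ring

/-- A transfer preserves the sum, so `(a + δ + n) * (b - δ + n)` exceeds `(a + n) * (b + n)` by `δ *
(b - a - δ)`, which is nonnegative and free of `n`. Hence the factor is again a mixture. -/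
lemma factor_of_transfer {a b δ : ℝ} (ha : 0 < a) (hδ : 0 ≤ δ) (hab : a + δ ≤ b) :
    IsHausdorffMoment fun n => a * (a + δ + n) / ((a + n) * (a + δ)) *
      (b * (b - δ + n) / ((b + n) * (b - δ))) := by
  have hb : 0 < b := by linarith
  have hb' : 0 < b - δ := by linarith
  have ha' : 0 < a + δ := by linarith
  convert one.convexComb ((div_add ha).mul (div_add hb)) (p := a * b / ((a + δ) * (b - δ)))
    (r := δ * (b - a - δ) / ((a + δ) * (b - δ))) (by positivity)
    (div_nonneg (mul_nonneg hδ (by linarith)) (by positivity)) (by field_simp; ring)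
    using 2 with n
  have h1 : 0 < a + n := by positivity
  have h2 : 0 < b + n := by positivity
  field_simp
  ring

lemma pochRatio_of_le {q : ℕ} {A B : Fin q → ℝ} (hA : ∀ i, 0 < A i) (hAB : ∀ i, A i ≤ B i) :
    IsHausdorffMoment (pochRatio A B) := by
  refine pochRatio_of_factor hA (fun i => (hA i).trans_le (hAB i)) fun k => prod _ fun i _ => ?_
  exact factor_of_le (a := A i + k) (b := B i + k) (by have := hA i; positivity)
    (by have := hAB i; linarith)

lemma pochRatio_of_transfer {q : ℕ} {A C : Fin q → ℝ} (hA : ∀ i, 0 < A i) {j k : Fin q}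
    (hjk : j ≠ k) {δ : ℝ} (hδ : 0 ≤ δ) (hjδ : A j + δ ≤ A k) (hj : C j = A j + δ)
    (hk : C k = A k - δ) (hC : ∀ i, i ≠ j → i ≠ k → C i = A i) :
    IsHausdorffMoment (pochRatio A C) := by
  have hC0 : ∀ i, 0 < C i := fun i => by
    by_cases h1 : i = j
    · subst h1; have := hA i; linarith
    by_cases h2 : i = k
    · subst h2; have := hA j; linarith
    rw [hC i h1 h2]
    exact hA i
  refine pochRatio_of_factor hA hC0 fun l => ?_
  have hj0 := hA j
  convert factor_of_transfer (a := A j + l) (b := A k + l) (by positivity) hδ (by linarith)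
    using 2 with n
  rw [Finset.prod_eq_mul j k hjk (fun i _ hi => ?_) (by simp) (by simp), hj, hk]
  · congr 2 <;> ring
  · rw [hC i hi.1 hi.2]
    have := hA i
    field_simp

/-- The moment sequence attached to a weakly supermajorized vector. Only the monotonicity of `B`
is needed. -/
theorem pochRatio_of_sum_le {q : ℕ} {A B : Fin q → ℝ} (hA : ∀ i, 0 < A i) (hB : ∀ i, 0 < B i)
    (hmono : Monotone B) (hsum : ∀ k, ∑ i ∈ Finset.Iic k, A i ≤ ∑ i ∈ Finset.Iic k, B i) :
    IsHausdorffMoment (pochRatio A B) := by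
  -- Each transfer makes at least one more coordinate agree with `B`. The intermediate vectors need
  -- not be monotone, so `A` is generalized without that condition.
  induction hd : (Finset.univ.filter fun i => A i ≠ B i).card using Nat.strong_induction_on
    generalizing A with
  | _ d ih =>
  by_cases hle : ∀ i, A i ≤ B i
  · exact pochRatio_of_le hA hle
  push Not at hle
  obtain ⟨k, hk, hmin⟩ := WellFounded.has_min (wellFounded_lt (α := Fin q)) {k | B k < A k} hle
  have hmin' : ∀ i < k, A i ≤ B i := fun i hi => not_lt.mp fun h => hmin i h hi
  -- Otherwise the partial sum up to `k` would be larger for `A`.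
  obtain ⟨j, hjk, hj⟩ : ∃ j < k, A j < B j := by
    by_contra! hcon
    refine (hsum k).not_gt (Finset.sum_lt_sum (fun i hi => ?_) ⟨k, by simp, hk⟩)
    rcases (Finset.mem_Iic.mp hi).lt_or_eq with h | rfl
    · exact hcon i h
    · exact le_of_lt hk
  have hk' : B k < A k := hk
  have hjne : j ≠ k := hjk.ne
  -- The largest transfer that overshoots neither `B j` nor `B k`; it reaches one of them.
  set δ := min (B j - A j) (A k - B k) with hδ
  have hδ1 : δ ≤ B j - A j := min_le_left _ _
  have hδ2 : δ ≤ A k - B k := min_le_right _ _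
  have hδ0 : 0 < δ := lt_min (by linarith) (by linarith)
  have hBjk := hmono hjk.le
  set C : Fin q → ℝ := Function.update (Function.update A j (A j + δ)) k (A k - δ) with hCdef
  have hCk : C k = A k - δ := by simp [hCdef]
  have hCj : C j = A j + δ := by simp [hCdef, hjne]
  have hCi : ∀ i, i ≠ j → i ≠ k → C i = A i := fun i h1 h2 => by simp [hCdef, h1, h2]
  have hC0 : ∀ i, 0 < C i := fun i => by
    by_cases h1 : i = j
    · subst h1; have := hA i; linarith
    by_cases h2 : i = k
    · subst h2; have := hB i; linarith
    rw [hCi i h1 h2]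
    exact hA i
  have hfun : pochRatio A B = fun n => pochRatio A C n * pochRatio C B n :=
    funext fun n => pochRatio_trans A B hC0 n
  rw [hfun]
  refine (pochRatio_of_transfer hA hjne hδ0.le (by linarith) hCj hCk hCi).mul
    (ih _ ?_ hC0 (fun m => ?_) rfl)
  · rw [← hd]
    refine Finset.card_lt_card ⟨fun i hi => ?_, fun hsub => ?_⟩
    · simp only [Finset.mem_filter, Finset.mem_univ, true_and] at hi ⊢
      by_cases h1 : i = j
      · subst h1; exact hj.ne
      by_cases h2 : i = k
      · subst h2; exact hk'.ne'
      rwa [hCi i h1 h2] at hi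
    · rcases min_choice (B j - A j) (A k - B k) with h | h
      · have := hsub (x := j) (by simp [hj.ne])
        simp only [Finset.mem_filter, Finset.mem_univ, true_and] at this
        exact this (by rw [hCj, hδ, h]; ring)
      · have := hsub (x := k) (by simp [hk'.ne'])
        simp only [Finset.mem_filter, Finset.mem_univ, true_and] at this
        exact this (by rw [hCk, hδ, h]; ring)
  -- From `k` on the transfer cancels in the partial sums; before `k` the bound by `B` holds
  -- termwise.
  · by_cases hm : k ≤ m
    · refine le_of_eq_of_le ?_ (hsum m)
      have hjm : j ∈ Finset.Iic m := Finset.mem_Iic.mpr (hjk.le.trans hm)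
      have hkm : k ∈ (Finset.Iic m).erase j :=
        Finset.mem_erase.mpr ⟨hjne.symm, Finset.mem_Iic.mpr hm⟩
      rw [← Finset.add_sum_erase _ C hjm, ← Finset.add_sum_erase _ A hjm,
        ← Finset.add_sum_erase _ C hkm, ← Finset.add_sum_erase _ A hkm, hCj, hCk,
        Finset.sum_congr rfl fun i hi => ?_]
      · ring
      · simp only [Finset.mem_erase] at hi
        exact hCi i hi.2.1 hi.1
    · refine Finset.sum_le_sum fun i hi => ?_
      have hik : i < k := (Finset.mem_Iic.mp hi).trans_lt (not_le.mp hm)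
      by_cases h1 : i = j
      · subst h1; linarith
      rw [hCi i h1 hik.ne]
      exact hmin' i hik

end IsHausdorffMoment

/-! ### Integrals of the kernel on the cut plane -/

lemma isOpen_cutPlane : IsOpen cutPlane := by
  have h : cutPlane = (fun z : ℂ => 1 - z) ⁻¹' Complex.slitPlane := by
    rw [cutPlane_eq]
    ext z
    constructor
    · rintro ⟨w, hw, rfl⟩
      simpa using hw
    · exact fun hz => ⟨1 - z, hz, by ring⟩
  rw [h]
  exact Complex.isOpen_slitPlane.preimage (by fun_prop)

lemma one_sub_mul_mem_slitPlane {z : ℂ} (hz : z ∈ cutPlane) (t : unitInterval) :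
    1 - z * (t : ℝ) ∈ Complex.slitPlane := by
  rw [Complex.mem_slitPlane_iff]
  obtain ⟨t, ht0, ht1⟩ := t
  by_cases him : z.im = 0
  · left
    have hre := hz him
    simp only [Complex.sub_re, Complex.one_re, Complex.re_mul_ofReal]
    rcases le_or_gt z.re 0 with h | h
    · nlinarith
    · nlinarith
  · rcases ht0.eq_or_lt with rfl | h
    · simp
    · right
      simp [him, h.ne']

lemma differentiableOn_integral_unitInterval (μ : Measure unitInterval) [IsFiniteMeasure μ]
    {U : Set ℂ} (hU : IsOpen U) {f f' : ℂ → unitInterval → ℂ}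
    (hf : ContinuousOn (Function.uncurry f) (U ×ˢ Set.univ))
    (hf' : ContinuousOn (Function.uncurry f') (U ×ˢ Set.univ))
    (hderiv : ∀ z ∈ U, ∀ t, HasDerivAt (fun w => f w t) (f' z t) z) :
    DifferentiableOn ℂ (fun z => ∫ t, f z t ∂μ) U := by
  have hsec : ∀ g : ℂ → unitInterval → ℂ, ContinuousOn (Function.uncurry g) (U ×ˢ Set.univ) →
      ∀ z ∈ U, Continuous (g z) := fun g hg z hz =>
    hg.comp_continuous (f := fun t => (z, t)) (by fun_prop) fun t => ⟨hz, trivial⟩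
  intro z hz
  obtain ⟨ε, hε, hball⟩ := Metric.nhds_basis_closedBall.mem_iff.mp (hU.mem_nhds hz)
  obtain ⟨M, hM⟩ := ((isCompact_closedBall z ε).prod isCompact_univ).exists_bound_of_continuousOn
    (hf'.mono (Set.prod_mono hball Set.Subset.rfl))
  refine (hasDerivAt_integral_of_dominated_loc_of_deriv_le (bound := fun _ => M)
    (Metric.closedBall_mem_nhds z hε) ?_
    (integrable_of_continuous_unitInterval μ (hsec f hf z hz))
    (hsec f' hf' z hz).aestronglyMeasurable
    (Eventually.of_forall fun t w hw => hM (w, t) ⟨hw, trivial⟩) (integrable_const M)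
    (Eventually.of_forall fun t w hw =>
      hderiv w (hball hw) t)).2.differentiableAt.differentiableWithinAt
  filter_upwards [hU.mem_nhds hz] with w hw
  exact (hsec f hf w hw).aestronglyMeasurable

lemma analyticOnNhd_integral_kernel (μ : Measure unitInterval) [IsFiniteMeasure μ] (s : ℂ)
    {g : unitInterval → ℂ} (hg : Continuous g) :
    AnalyticOnNhd ℂ (fun z => ∫ t, g t * (1 - z * (t : ℝ)) ^ s ∂μ) cutPlane := by
  have hcpow : ∀ r : ℂ, ContinuousOn
      (fun p : ℂ × unitInterval => (1 - p.1 * ((p.2 : ℝ) : ℂ)) ^ r) (cutPlane ×ˢ Set.univ) :=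
    fun r => ContinuousOn.cpow (by fun_prop) continuousOn_const
      fun p hp => one_sub_mul_mem_slitPlane hp.1 p.2
  refine (differentiableOn_integral_unitInterval μ isOpen_cutPlane
    (f' := fun z t => g t * (s * (1 - z * (t : ℝ)) ^ (s - 1) * -((t : ℝ) : ℂ))) ?_ ?_
    fun z hz t => ?_).analyticOnNhd isOpen_cutPlane
  · exact ContinuousOn.mul (by fun_prop) (hcpow s)
  · exact ContinuousOn.mul (by fun_prop)
      ((continuousOn_const.mul (hcpow (s - 1))).mul (by fun_prop))
  · have h1 : HasDerivAt (fun w : ℂ => 1 - w * ((t : ℝ) : ℂ)) (-((t : ℝ) : ℂ)) z := by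
      simpa using ((hasDerivAt_id z).mul_const ((t : ℝ) : ℂ)).const_sub 1
    exact (h1.cpow_const (one_sub_mul_mem_slitPlane hz t)).const_mul (g t)

lemma hasSum_ascPochhammer_one_sub_cpow (s : ℂ) {w : ℂ} (hw : ‖w‖ < 1) :
    HasSum (fun n : ℕ => (ascPochhammer ℂ n).eval s / n.factorial * w ^ n) ((1 - w) ^ (-s)) := by
  have hmem : w ∈ Metric.eball (0 : ℂ) 1 := by
    rw [← ENNReal.ofReal_one, Metric.eball_ofReal]
    simpa using hw
  have h := (Complex.one_div_one_sub_cpow_hasFPowerSeriesOnBall_zero s).hasSum hmem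
  rw [zero_add, one_div, ← Complex.cpow_neg] at h
  refine h.congr_fun fun n => ?_
  have hfac : ((n.factorial : ℕ) : ℂ) ≠ 0 := by exact_mod_cast n.factorial_ne_zero
  have h2 := Ring.factorial_nsmul_multichoose_eq_ascPochhammer s n
  rw [Polynomial.ascPochhammer_smeval_eq_eval, nsmul_eq_mul, Ring.multichoose_eq] at h2
  simp [FormalMultilinearSeries.ofScalars, ← h2, hfac]

lemma hasSum_integral_kernel (μ : Measure unitInterval) [IsFiniteMeasure μ] (s : ℂ)
    {g : unitInterval → ℂ} (hg : Continuous g) {z : ℂ} (hz : ‖z‖ < 1) :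
    HasSum (fun n : ℕ => (ascPochhammer ℂ n).eval s / n.factorial *
        (∫ t, g t * ((t : ℝ) : ℂ) ^ n ∂μ) * z ^ n)
      (∫ t, g t * (1 - z * (t : ℝ)) ^ (-s) ∂μ) := by
  obtain ⟨M, hM⟩ := isCompact_univ.exists_bound_of_continuousOn (f := g) hg.continuousOn
  set F : ℕ → unitInterval → ℂ := fun n t =>
    g t * ((ascPochhammer ℂ n).eval s / n.factorial * (z * (t : ℝ)) ^ n) with hF
  have hFc : ∀ n, Continuous (F n) := fun n => by fun_prop
  have hbound : ∀ n t, ‖F n t‖ ≤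
      M * ‖(ascPochhammer ℂ n).eval s / n.factorial * (‖z‖ : ℂ) ^ n‖ := fun n t => by
    have ht : ‖((t : ℝ) : ℂ)‖ ≤ 1 := by
      rw [Complex.norm_real, Real.norm_of_nonneg t.2.1]
      exact t.2.2
    have hM0 : 0 ≤ M := (norm_nonneg _).trans (hM t trivial)
    have hzt : ‖z * ((t : ℝ) : ℂ)‖ ≤ ‖z‖ := by
      rw [norm_mul]
      exact mul_le_of_le_one_right (norm_nonneg z) ht
    rw [hF]
    simp only [norm_mul _ (_ ^ n), norm_mul (g t), norm_pow, Complex.norm_real, norm_norm]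
    gcongr
    exact hM t trivial
  -- The dominating series is the binomial series at the point `‖z‖ < 1`, which converges
  -- absolutely.
  have hsum : Summable fun n => ∫ t, ‖F n t‖ ∂μ := by
    refine Summable.of_nonneg_of_le (fun n => integral_nonneg fun t => norm_nonneg _)
      (fun n => (integral_mono (integrable_of_continuous_unitInterval μ (hFc n).norm)
        (integrable_const _) (hbound n)).trans_eq (integral_const _)) ?_
    have hzr : ‖(‖z‖ : ℂ)‖ < 1 := by simpa using hz
    exact ((hasSum_ascPochhammer_one_sub_cpow s hzr).summable.norm.mul_left M).const_smul _
  convert! hasSum_integral_of_summable_integral_norm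
    (fun n => integrable_of_continuous_unitInterval μ (hFc n)) hsum using 1
  · ext n
    rw [mul_right_comm, ← integral_const_mul]
    refine integral_congr_ae (Eventually.of_forall fun t => ?_)
    simp only [hF, mul_pow]
    ring
  · refine integral_congr_ae (Eventually.of_forall fun t => ?_)
    have hzt : ‖z * ((t : ℝ) : ℂ)‖ < 1 := by
      rw [norm_mul, Complex.norm_real, Real.norm_of_nonneg t.2.1]
      exact (mul_le_of_le_one_right (norm_nonneg z) t.2.2).trans_lt hz
    exact ((hasSum_ascPochhammer_one_sub_cpow s hzt).mul_left (g t)).tsum_eq.symm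

/-! ### Strict Jensen inequality -/

lemma strictConcaveOn_mul_rpow {σ x : ℝ} (hσ0 : 0 < σ) (hσ1 : σ ≤ 1) (hx : 0 < x) :
    StrictConcaveOn ℝ (Set.Ici 0) fun t : ℝ => t * (1 + x * t) ^ (-σ) := by
  have hpos : ∀ t : ℝ, 0 ≤ t → 0 < 1 + x * t := fun t ht => by positivity
  have hcont : ContinuousOn (fun t : ℝ => t * (1 + x * t) ^ (-σ)) (Set.Ici 0) :=
    continuousOn_id.mul (ContinuousOn.rpow_const (by fun_prop) fun t ht => Or.inl (hpos t ht).ne')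
  refine StrictAntiOn.strictConcaveOn_of_deriv (convex_Ici 0) hcont ?_
  have hderiv : ∀ t ∈ interior (Set.Ici (0 : ℝ)), deriv (fun t : ℝ => t * (1 + x * t) ^ (-σ)) t =
      (1 - σ) * (1 + x * t) ^ (-σ) + σ * (1 + x * t) ^ (-σ - 1) := fun t ht => by
    rw [interior_Ici] at ht
    have hp := hpos t (le_of_lt ht)
    have h1 : HasDerivAt (fun t : ℝ => 1 + x * t) x t := by
      simpa using ((hasDerivAt_id t).const_mul x).const_add 1
    have h2 := (hasDerivAt_id t).mul (h1.rpow_const (p := -σ) (Or.inl hp.ne'))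
    refine HasDerivAt.deriv (h2.congr_deriv ?_)
    have h3 : (1 + x * t) ^ (-σ) = (1 + x * t) ^ (-σ - 1) * (1 + x * t) := by
      rw [← Real.rpow_add_one hp.ne']
      congr 1
      ring
    simp only [id, h3]
    ring
  intro s hs t ht hst
  rw [hderiv s hs, hderiv t ht]
  rw [interior_Ici] at hs
  have hps := hpos s (le_of_lt hs)
  have hlt : 1 + x * s < 1 + x * t := by gcongr
  have h1 := Real.rpow_lt_rpow_of_neg hps hlt (z := -σ) (by linarith)
  have h2 := Real.rpow_lt_rpow_of_neg hps hlt (z := -σ - 1) (by linarith)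
  -- `σ ≤ 1` keeps the first term of the derivative nonincreasing; the second supplies strictness,
  -- even at `σ = 1`.
  exact add_lt_add_of_le_of_lt (mul_le_mul_of_nonneg_left h1.le (by linarith))
    (mul_lt_mul_of_pos_left h2 hσ0)

lemma integral_mul_rpow_lt (μ : Measure unitInterval) [IsProbabilityMeasure μ] {σ x : ℝ}
    (hσ0 : 0 < σ) (hσ1 : σ ≤ 1) (hx : 0 < x)
    (hne : ¬ ∀ᵐ t : unitInterval ∂μ, (t : ℝ) = ∫ u, (u : ℝ) ∂μ) :
    ∫ t, (t : ℝ) * (1 + x * t) ^ (-σ) ∂μ <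
      (∫ t, (t : ℝ) ∂μ) * (1 + x * ∫ t, (t : ℝ) ∂μ) ^ (-σ) := by
  have hcont : ContinuousOn (fun t : ℝ => t * (1 + x * t) ^ (-σ)) (Set.Ici 0) :=
    continuousOn_id.mul (ContinuousOn.rpow_const (by fun_prop) fun t ht =>
      Or.inl (by have : 0 ≤ t := ht; positivity))
  rcases (strictConcaveOn_mul_rpow hσ0 hσ1 hx).ae_eq_const_or_lt_map_average (μ := μ)
    (f := fun t : unitInterval => (t : ℝ)) hcont isClosed_Ici
    (Eventually.of_forall fun t => t.2.1)
    (integrable_of_continuous_unitInterval μ continuous_subtype_val)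
    (integrable_of_continuous_unitInterval μ
      (hcont.comp_continuous continuous_subtype_val fun t => t.2.1)) with h | h
  · rw [average_eq_integral] at h
    exact absurd h hne
  · simpa only [average_eq_integral] using h

/-! ### Excluding a point mass -/

/-- The monic polynomials with roots `A` and `B` agree at every `-n`, hence coincide; sorting the
common multiset of roots recovers both vectors. -/
lemma eq_of_forall_prod_add_natCast_eq {q : ℕ} {A B : Fin q → ℝ} (hA : Monotone A)
    (hB : Monotone B) (h : ∀ n : ℕ, ∏ i, (A i + n) = ∏ i, (B i + n)) : A = B := by
  have hroots : ∀ C : Fin q → ℝ, (((Finset.univ.val.map C).map fun a : ℝ =>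
      Polynomial.X - Polynomial.C a).prod).roots = Finset.univ.val.map C :=
    fun C => Polynomial.roots_multiset_prod_X_sub_C _
  have heval : ∀ (C : Fin q → ℝ) (n : ℕ), (((Finset.univ.val.map C).map fun a : ℝ =>
      Polynomial.X - Polynomial.C a).prod).eval (-(n : ℝ)) = (-1) ^ q * ∏ i, (C i + n) :=
    fun C n => by
      rw [Multiset.map_map, ← Finset.prod_eq_multiset_prod, Polynomial.eval_prod]
      simp only [Function.comp, Polynomial.eval_sub, Polynomial.eval_X, Polynomial.eval_C]
      have h1 : ∀ i, -(n : ℝ) - C i = -1 * (C i + n) := fun i => by ring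
      simp only [h1, Finset.prod_mul_distrib, Finset.prod_const, Finset.card_univ, Fintype.card_fin]
  have hpoly := Polynomial.eq_of_infinite_eval_eq
    ((Finset.univ.val.map A).map fun a : ℝ => Polynomial.X - Polynomial.C a).prod
    ((Finset.univ.val.map B).map fun a : ℝ => Polynomial.X - Polynomial.C a).prod
    (Set.infinite_of_injective_forall_mem (f := fun n : ℕ => -(n : ℝ))
      (fun m n hmn => by simpa using hmn)
      fun n => show Polynomial.eval _ _ = Polynomial.eval _ _ by rw [heval, heval, h])
  have hms := congrArg Polynomial.roots hpoly
  rw [hroots, hroots, Fin.univ_val_map, Fin.univ_val_map, Multiset.coe_eq_coe] at hms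
  exact List.ofFn_injective (hms.eq_of_pairwise' hA.sortedLE_ofFn.pairwise
    hB.sortedLE_ofFn.pairwise)

lemma pochRatio_succ {q : ℕ} (A B : Fin q → ℝ) (n : ℕ) :
    pochRatio A B (n + 1) = pochRatio A B n * ((∏ i, (A i + n)) / ∏ i, (B i + n)) := by
  simp only [pochRatio, ascPochhammer_succ_eval, mul_div_mul_comm, Finset.prod_mul_distrib,
    Finset.prod_div_distrib]

lemma pochRatio_succ_left {q : ℕ} (A B : Fin q → ℝ) (n : ℕ) :
    pochRatio A B (n + 1) =
      (∏ i, A i / B i) * pochRatio (fun i => A i + 1) (fun i => B i + 1) n := by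
  simp only [pochRatio, ascPochhammer_succ_left, Polynomial.eval_mul, Polynomial.eval_X,
    Polynomial.eval_comp, Polynomial.eval_add, Polynomial.eval_one, mul_div_mul_comm,
    Finset.prod_mul_distrib]

/-- Consecutive ratios are constantly `c` but tend to 1, so `c = 1` and the products of `A i + n`
and `B i + n` agree for all `n`. -/
lemma eq_of_pochRatio_eq_pow {q : ℕ} {A B : Fin q → ℝ} (hA0 : ∀ i, 0 < A i) (hB0 : ∀ i, 0 < B i)
    (hA : Monotone A) (hB : Monotone B) {c : ℝ} (hc : ∀ n, pochRatio A B n = c ^ n) : A = B := by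
  have hc0 : 0 < c := by
    have := pochRatio_pos hA0 hB0 1
    rwa [hc, pow_one] at this
  have hratio : ∀ n : ℕ, (∏ i, (A i + n)) / ∏ i, (B i + n) = c := fun n => by
    have h1 := pochRatio_succ A B n
    rw [hc, hc, pow_succ] at h1
    exact (mul_left_cancel₀ (pow_pos hc0 n).ne' h1).symm
  have hlim : Tendsto (fun n : ℕ => (∏ i, (A i + n)) / ∏ i, (B i + n)) atTop (𝓝 1) := by
    simpa [pochRatio] using tendsto_pochRatio_one A B 1
  simp only [hratio] at hlim
  have hc1 : c = 1 := tendsto_nhds_unique tendsto_const_nhds hlim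
  refine eq_of_forall_prod_add_natCast_eq hA hB fun n => ?_
  have hpos : 0 < ∏ i, (B i + (n : ℝ)) :=
    Finset.prod_pos fun i _ => add_pos_of_pos_of_nonneg (hB0 i) n.cast_nonneg
  have h1 := hratio n
  rwa [hc1, div_eq_one_iff_eq hpos.ne'] at h1

/-! ### Integral representation and the main inequality -/

lemma ascPochhammer_eval_ofReal (n : ℕ) (a : ℝ) :
    (ascPochhammer ℂ n).eval (a : ℂ) = (((ascPochhammer ℝ n).eval a : ℝ) : ℂ) := by
  induction n with
  | zero => simp
  | succ n ih => rw [ascPochhammer_succ_eval, ascPochhammer_succ_eval, ih]; push_cast; rfl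

lemma hypTerm_ofReal {q : ℕ} (s : ℂ) (A B : Fin q → ℝ) (z : ℂ) (n : ℕ) :
    hypTerm s (fun i => (A i : ℂ)) (fun i => (B i : ℂ)) z n =
      (ascPochhammer ℂ n).eval s / n.factorial * pochRatio A B n * z ^ n := by
  simp only [hypTerm, pochRatio, ascPochhammer_eval_ofReal, Finset.prod_div_distrib]
  push_cast
  rw [div_mul_div_comm, mul_comm (n.factorial : ℂ)]

/-- If the numbers `pochRatio A B n` are the moments of a finite measure with continuous density
`g` with respect to `μ`, then `_{q+1}F_q(s, A; B; ·)` is the generalized Stieltjes transform of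
that measure. -/
lemma isHypContinuation_integral {q : ℕ} (s : ℂ) {A B : Fin q → ℝ} (μ : Measure unitInterval)
    [IsFiniteMeasure μ] {g : unitInterval → ℝ} (hg : Continuous g)
    (hmom : ∀ n, ∫ t, g t * (t : ℝ) ^ n ∂μ = pochRatio A B n) :
    IsHypContinuation s (fun i => (A i : ℂ)) (fun i => (B i : ℂ))
      fun z => ∫ t, (g t : ℂ) * (1 - z * (t : ℝ)) ^ (-s) ∂μ where
  analytic := analyticOnNhd_integral_kernel μ (-s) (Complex.continuous_ofReal.comp hg)
  hasSum z hz := by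
    refine (hasSum_integral_kernel μ s (Complex.continuous_ofReal.comp hg) hz).congr_fun
      fun n => ?_
    rw [hypTerm_ofReal, ← hmom, ← integral_complex_ofReal]
    push_cast
    rfl

lemma integral_kernel_neg_ofReal (μ : Measure unitInterval) (g : unitInterval → ℝ) (σ : ℝ) {x : ℝ}
    (hx : 0 < x) :
    ∫ t, (g t : ℂ) * (1 - -(x : ℂ) * (t : ℝ)) ^ (-(σ : ℂ)) ∂μ =
      ((∫ t, g t * (1 + x * t) ^ (-σ) ∂μ : ℝ) : ℂ) := by
  rw [← integral_complex_ofReal]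
  refine integral_congr_ae (Eventually.of_forall fun t => ?_)
  have h : 0 ≤ 1 + x * (t : ℝ) := by have := t.2.1; positivity
  simp only [Complex.ofReal_mul, Complex.ofReal_cpow h]
  push_cast
  ring_nf

lemma IsHypContinuation.isHypContinuation_genHyp {q : ℕ} {σ : ℂ} {A B : Fin q → ℂ} {F : ℂ → ℂ}
    (hF : IsHypContinuation σ A B F) : IsHypContinuation σ A B (genHyp σ A B) := by
  have h : ∃ F, IsHypContinuation σ A B F := ⟨F, hF⟩
  rw [genHyp, dif_pos h]
  exact h.choose_spec

theorem mainTheorem6 (q : ℕ) (hq : 0 < q) (A B : Fin q → ℝ)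
    (hBA : WeaklySupermajorizedBy B A) (hne : A ≠ B)
    (hA1 : 1 < A ⟨0, hq⟩) (hB1 : 1 < B ⟨0, hq⟩)
    (σ : ℝ) (hσ0 : 0 < σ) (hσ1 : σ ≤ 1) :
    IsHypContinuation (σ : ℂ) (fun i => (A i : ℂ)) (fun i => (B i : ℂ))
        (genHyp (σ : ℂ) (fun i => (A i : ℂ)) (fun i => (B i : ℂ))) ∧
      ∀ x : ℝ, 0 < x →
        (genHyp (σ : ℂ) (fun i => (A i : ℂ)) (fun i => (B i : ℂ)) (-(x : ℂ))).im = 0 ∧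
        (genHyp (σ : ℂ) (fun i => (A i : ℂ)) (fun i => (B i : ℂ)) (-(x : ℂ))).re <
          1 / (1 + x * ∏ i, ((A i - 1) / (B i - 1))) ^ σ := by
  have hA0 : ∀ i, 0 < A i - 1 := fun i => by
    have := hBA.mono_A (show (⟨0, hq⟩ : Fin q) ≤ i from Nat.zero_le _)
    linarith
  have hB0 : ∀ i, 0 < B i - 1 := fun i => by
    have := hBA.mono_B (show (⟨0, hq⟩ : Fin q) ≤ i from Nat.zero_le _)
    linarith
  have hAm : Monotone fun i => A i - 1 := fun i j hij => sub_le_sub_right (hBA.mono_A hij) 1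
  have hBm : Monotone fun i => B i - 1 := fun i j hij => sub_le_sub_right (hBA.mono_B hij) 1
  -- The shift gains the factor `t` in the integrand: `(1 + x * t) ^ (-σ)` alone is convex, and
  -- Jensen would point the other way.
  obtain ⟨ν, hν⟩ := IsHausdorffMoment.pochRatio_of_sum_le hA0 hB0 hBm fun k => by
    simpa only [Finset.sum_sub_distrib] using sub_le_sub_right (hBA.sum_le k) _
  set c := ∏ i, ((A i - 1) / (B i - 1)) with hc
  have hc0 : 0 < c := Finset.prod_pos fun i _ => div_pos (hA0 i) (hB0 i)
  have hmom : ∀ n : ℕ, ∫ t : unitInterval, (t : ℝ) / c * (t : ℝ) ^ n ∂(ν : Measure unitInterval) =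
      pochRatio A B n := fun n => by
    have h1 : ∀ t : unitInterval, (t : ℝ) / c * (t : ℝ) ^ n = c⁻¹ * (t : ℝ) ^ (n + 1) :=
      fun t => by ring
    simp only [h1]
    rw [integral_const_mul, hν, pochRatio_succ_left, ← hc]
    simp only [sub_add_cancel]
    field_simp
  have hmean : ∫ t : unitInterval, (t : ℝ) ∂(ν : Measure unitInterval) = c := by
    have h1 := hν 1
    rw [pochRatio_succ_left, ← hc] at h1
    simpa [pochRatio] using h1
  have hF := isHypContinuation_integral (σ : ℂ) (ν : Measure unitInterval)
    (g := fun t => (t : ℝ) / c) (by fun_prop) hmom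
  refine ⟨hF.isHypContinuation_genHyp, fun x hx => ?_⟩
  have hval := hF.genHyp_eqOn (x := -(x : ℂ)) fun _ => by
    rw [Complex.neg_re, Complex.ofReal_re]
    linarith
  rw [integral_kernel_neg_ofReal (ν : Measure unitInterval) _ σ hx] at hval
  rw [hval, Complex.ofReal_im, Complex.ofReal_re]
  refine ⟨rfl, ?_⟩
  have hlt := integral_mul_rpow_lt (ν : Measure unitInterval) hσ0 hσ1 hx fun hae => hne ?_
  · rw [hmean] at hlt
    have h1 : ∀ t : unitInterval, (t : ℝ) / c * (1 + x * t) ^ (-σ) =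
        c⁻¹ * ((t : ℝ) * (1 + x * t) ^ (-σ)) := fun t => by ring
    simp only [h1]
    rw [integral_const_mul, one_div, ← Real.rpow_neg (by positivity)]
    calc _ < c⁻¹ * (c * (1 + x * c) ^ (-σ)) := mul_lt_mul_of_pos_left hlt (inv_pos.mpr hc0)
      _ = _ := inv_mul_cancel_left₀ hc0.ne' _
  · have hpow : ∀ n, pochRatio (fun i => A i - 1) (fun i => B i - 1) n = c ^ n := fun n => by
      rw [← hν, integral_congr_ae (g := fun _ => c ^ n) (by
        filter_upwards [hae] with t ht
        rw [ht, hmean])]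
      simp
    funext i
    simpa using congrFun (eq_of_pochRatio_eq_pow hA0 hB0 hAm hBm hpow) i
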